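/- Let $n\ge 1$ and $m\ge n$ be integers, let $a\neq 0$ be a real number, and let $f:\mathbb{R}\to\mathbb{R}$ be an arbitrary function (no continuity or other regularity is assumed). Let $u\in C^\infty([0,1))$ be a real-valued function (smooth up to $0$, with one-sided derivatives there) such that $$u^{(n)}(t)=f(u(t))\quad\text{for all } t\in[0,1),$$ $$u(0)=u'(0)=\cdots=u^{(m-1)}(0)=0,\qquad u^{(m)}(0)=a .$$ Then $u$ is the unique such solution for $t$ near $0$: there is $\varepsilon\in(0,1]$ such that every $v\in C^\infty([0,1))$ with $v^{(n)}(t)=f(v(t))$ for all $t\in[0,1)$, $v(0)=v'(0)=\cdots=v^{(m-1)}(0)=0$ and $v^{(m)}(0)=a$ (with the same $n$, $m$, $f$ and $a$) satisfies $v(t)=u(t)$ for all $t\in[0,\varepsilon)$. -/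

import Mathlib

open Set
open scoped ContDiff

/-- `u ∈ C^∞([0,1))` (one-sided derivatives at `0`) solves the autonomous equation
`u^{(n)}(t) = f(u(t))` on `[0,1)` and satisfies the initial conditions
`u(0) = u'(0) = ⋯ = u^{(m-1)}(0) = 0` and `u^{(m)}(0) = a`. -/
structure IsVanishingSolution (n m : ℕ) (f : ℝ → ℝ) (a : ℝ) (u : ℝ → ℝ) : Prop where
  smooth : ContDiffOn ℝ ∞ u (Ico 0 1)
  equation : ∀ t ∈ Ico (0 : ℝ) 1, iteratedDerivWithin n u (Ico 0 1) t = f (u t)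
  vanish : ∀ k < m, iteratedDerivWithin k u (Ico 0 1) 0 = 0
  leading : iteratedDerivWithin m u (Ico 0 1) 0 = a

/-!
Let `u`, `v` be two solutions with `a > 0`, and put `w = v - u`. Where `u' > 0`, every value `v t`
close to `u t` is a value `u τ`, and then `v⁽ⁿ⁾ t = f (v t) = f (u τ) = u⁽ⁿ⁾ τ`. The unknown `f` is
thereby eliminated: `w⁽ⁿ⁾ t = u⁽ⁿ⁾ τ - u⁽ⁿ⁾ t` and `w t = u τ - u t`, so Cauchy's mean value
theorem (`IsDerivSeq.abs_sub_le`) bounds `|w⁽ⁿ⁾ t|` by `|w t|` times a bound for `|u⁽ⁿ⁺¹⁾| / u'`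
between `t` and `τ`.

At `0` that quotient may blow up. As `u` behaves like `a tᵐ / m!` and so do its derivatives,
`tⁿ |u⁽ⁿ⁺¹⁾| / u'` has the limit `(m - n) / m * (m! / (m - n)!)`
(`IsDerivSeq.eventually_ratio_le`); since `v` has the same leading term, `τ / t → 1`. Hence
`tⁿ |w⁽ⁿ⁾| ≤ q * (m! / (m - n)!) * |w|` near `0` for some `q < 1`. Integrating `n` times turns
`|w| ≤ M tᵐ` into `|w| ≤ q M tᵐ`, so `w = 0` near `0` (`IsDerivSeq.eq_zero_of_abs_le`).

At a point `s > 0` with `u' s > 0` the quotient is bounded, all derivatives of `w` vanish at `s` if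
`w` vanishes on `[0,s]`, and the same contraction (with `tⁿ` in place of `tᵐ`) continues the
equality to the right of `s`. A connectedness argument then gives `v = u` on every `[0,ε)` on whose
interior `u' > 0`, and this `ε` does not depend on `v`.
-/

open Filter Topology

/-! ### Sequences of successive derivatives -/

/-- `U k` is the `k`-th derivative of `U 0` on `[0,1)`, one-sided at `0`. Working with the whole
sequence lets derivatives be subtracted and shifted termwise. -/
def IsDerivSeq (U : ℕ → ℝ → ℝ) : Prop :=
  ∀ k, ∀ t ∈ Ico (0 : ℝ) 1, HasDerivWithinAt (U k) (U (k + 1) t) (Ico 0 1) t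

namespace IsDerivSeq

variable {U V W : ℕ → ℝ → ℝ}

lemma sub (hV : IsDerivSeq V) (hU : IsDerivSeq U) : IsDerivSeq fun k t => V k t - U k t :=
  fun k t ht => (hV k t ht).sub (hU k t ht)

lemma shift (hU : IsDerivSeq U) (j : ℕ) : IsDerivSeq fun k => U (j + k) :=
  fun k t ht => hU (j + k) t ht

lemma continuousOn (hU : IsDerivSeq U) (k : ℕ) : ContinuousOn (U k) (Ico 0 1) :=
  fun t ht => (hU k t ht).continuousWithinAt

lemma hasDerivAt (hU : IsDerivSeq U) (k : ℕ) {t : ℝ} (ht : t ∈ Ioo (0 : ℝ) 1) :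
    HasDerivAt (U k) (U (k + 1) t) t :=
  (hU k t (Ioo_subset_Ico_self ht)).hasDerivAt (Ico_mem_nhds ht.1 ht.2)

lemma tendsto_zero (hU : IsDerivSeq U) (k : ℕ) : Tendsto (U k) (𝓝[>] 0) (𝓝 (U k 0)) := by
  have h := (hU.continuousOn k 0 (by simp)).tendsto
  rw [nhdsWithin_Ico_eq_nhdsGE one_pos] at h
  exact h.mono_left (nhdsWithin_mono _ Ioi_subset_Ici_self)

/-! ### Integral and mean value inequalities -/

/-- Integrating a bound by a power `n` times, from a point where the first `n` terms vanish. -/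
lemma abs_le_of_abs_le (hW : IsDerivSeq W) {s b : ℝ} (hs : 0 ≤ s) (hb : b < 1) {C : ℝ} {r n : ℕ}
    (h0 : ∀ k < n, W k s = 0)
    (hn : ∀ t ∈ Icc s b, |W n t| ≤ C * ((t - s) ^ r / r.factorial)) :
    ∀ t ∈ Icc s b, |W 0 t| ≤ C * ((t - s) ^ (r + n) / (r + n).factorial) := by
  induction n generalizing r with
  | zero => simpa using hn
  | succ n ih =>
    have key : ∀ t ∈ Icc s b, |W n t| ≤ C * ((t - s) ^ (r + 1) / (r + 1).factorial) := by
      have hsub : Icc s b ⊆ Ico 0 1 := fun x hx => ⟨hs.trans hx.1, hx.2.trans_lt hb⟩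
      refine image_norm_le_of_norm_deriv_right_le_deriv_boundary
        (f' := W (n + 1)) (B' := fun t => C * ((t - s) ^ r / r.factorial))
        ((hW.continuousOn n).mono hsub) ?_ ?_ ?_ ?_
      · intro x hx
        have hx' := hsub (Ico_subset_Icc_self hx)
        exact (hW n x hx').mono_of_mem_nhdsWithin
          (mem_of_superset (Ico_mem_nhdsGE hx'.2) (Ico_subset_Ico_left hx'.1))
      · simp [h0 n (by omega)]
      · intro x
        have h := ((((hasDerivAt_id x).sub_const s).pow (r + 1)).div_const
          ((r + 1).factorial : ℝ)).const_mul C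
        refine h.congr_deriv ?_
        have : (r.factorial : ℝ) ≠ 0 := by positivity
        have : (r : ℝ) + 1 ≠ 0 := by positivity
        simp only [Nat.factorial_succ, id]
        push_cast
        field_simp
      · exact fun x hx => hn x (Ico_subset_Icc_self hx)
    have := ih (r := r + 1) (fun k hk => h0 k (by omega)) key
    simpa only [show r + 1 + n = r + (n + 1) by omega] using this

/-- The singular differential inequality `|W⁽ⁿ⁾| ≤ q · (r+n)!/r! · (t-s)⁻ⁿ |W|` with `q < 1` forces
`W = 0` if `W` vanishes to order `r + n` at `s`: integrated `n` times, it improves a bound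
`|W| ≤ M (t-s)^(r+n)` to `|W| ≤ q M (t-s)^(r+n)`. -/
lemma eq_zero_of_abs_le (hW : IsDerivSeq W) {s b q : ℝ} (hs : 0 ≤ s) (hb : b < 1) (hq0 : 0 ≤ q)
    (hq : q < 1) {r n : ℕ} (h0 : ∀ k ≤ r + n, W k s = 0)
    (h : ∀ t ∈ Ioc s b, (t - s) ^ n * r.factorial * |W n t| ≤ q * (r + n).factorial * |W 0 t|) :
    ∀ t ∈ Icc s b, W 0 t = 0 := by
  have hsub : Icc s b ⊆ Ico 0 1 := fun x hx => ⟨hs.trans hx.1, hx.2.trans_lt hb⟩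
  -- `M` bounds the derivative of order `r + n`, so Taylor's formula gives the bound for `i = 0`
  obtain ⟨M, hM⟩ := isCompact_Icc.exists_bound_of_continuousOn
    ((hW.continuousOn (r + n)).mono hsub)
  have hpow : ∀ i : ℕ, ∀ t ∈ Icc s b,
      |W 0 t| ≤ q ^ i * M * ((t - s) ^ (r + n) / (r + n).factorial) := by
    intro i
    induction i with
    | zero =>
      have := hW.abs_le_of_abs_le hs hb (C := M) (r := 0) (n := r + n)
        (fun k hk => h0 k hk.le) (fun t ht => by simpa using hM t ht)
      simpa using this
    | succ i ih =>
      refine hW.abs_le_of_abs_le hs hb (fun k hk => h0 k (by omega)) ?_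
      intro t ht
      rcases ht.1.eq_or_lt with rfl | hlt
      · have hMn : 0 ≤ M := (norm_nonneg _).trans (hM _ ht)
        rw [h0 n (by omega), abs_zero]
        have : 0 ≤ (s - s) ^ r := by simp
        positivity
      · have hpos : 0 < t - s := sub_pos.2 hlt
        have h1 := h t ⟨hlt, ht.2⟩
        have h2 := ih t ht
        have h3 : (t - s) ^ n * r.factorial * |W n t| ≤
            q * (r + n).factorial * (q ^ i * M * ((t - s) ^ (r + n) / (r + n).factorial)) :=
          h1.trans (by gcongr)
        have hA : 0 < (t - s) ^ n * (r.factorial : ℝ) := by positivity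
        rw [← mul_le_mul_iff_right₀ hA]
        refine h3.trans (le_of_eq ?_)
        have : ((r + n).factorial : ℝ) ≠ 0 := by positivity
        field_simp
        ring
  intro t ht
  have hlim : Tendsto (fun i : ℕ => q ^ i * M * ((t - s) ^ (r + n) / (r + n).factorial)) atTop
      (𝓝 0) := by
    simpa using ((tendsto_pow_atTop_nhds_zero_of_lt_one hq0 hq).mul_const M).mul_const
      ((t - s) ^ (r + n) / ((r + n).factorial : ℝ))
  exact abs_eq_zero.1
    (le_antisymm (ge_of_tendsto' hlim fun i => hpow i t ht) (abs_nonneg _))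

/-- Cauchy's mean value inequality for `U n` against `U 0`. -/
lemma abs_sub_le (hU : IsDerivSeq U) {x y B : ℝ} {n : ℕ} (hB : 0 ≤ B) (hx : x ∈ Ioo (0 : ℝ) 1)
    (hy : y ∈ Ioo (0 : ℝ) 1) (h : ∀ z ∈ uIcc x y, |U (n + 1) z| ≤ B * U 1 z) :
    |U n y - U n x| ≤ B * |U 0 y - U 0 x| := by
  wlog hxy : x ≤ y generalizing x y
  · rw [abs_sub_comm, abs_sub_comm (U 0 y)]
    exact this hy hx (by rwa [uIcc_comm]) (le_of_not_ge hxy)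
  rw [uIcc_of_le hxy] at h
  have hsub : Icc x y ⊆ Ioo 0 1 := fun z hz => ⟨hx.1.trans_le hz.1, hz.2.trans_lt hy.2⟩
  have hd : ∀ c : ℝ, ∀ z ∈ Icc x y,
      HasDerivAt (fun z => B * U 0 z + c * U n z) (B * U 1 z + c * U (n + 1) z) z := fun c z hz =>
    ((hU.hasDerivAt 0 (hsub hz)).const_mul B).add ((hU.hasDerivAt n (hsub hz)).const_mul c)
  have hmono : ∀ c : ℝ, |c| = 1 → B * U 0 x + c * U n x ≤ B * U 0 y + c * U n y := by
    intro c hc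
    refine monotoneOn_of_deriv_nonneg (convex_Icc x y)
      (fun z hz => (hd c z hz).continuousAt.continuousWithinAt)
      (fun z hz => (hd c z (interior_subset hz)).differentiableAt.differentiableWithinAt)
      (fun z hz => ?_) (left_mem_Icc.2 hxy) (right_mem_Icc.2 hxy) hxy
    rw [(hd c z (interior_subset hz)).deriv]
    have h1 := h z (interior_subset hz)
    have h2 := neg_abs_le (c * U (n + 1) z)
    rw [abs_mul, hc, one_mul] at h2
    linarith
  have h1 := hmono 1 (by simp)
  have h2 := hmono (-1) (by simp)
  have h3 : |U n y - U n x| ≤ B * (U 0 y - U 0 x) := abs_le.2 ⟨by linarith, by linarith⟩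
  exact h3.trans (by gcongr; exact le_abs_self _)

/-- Two derivative sequences with the same base function on `[0,s]` agree there, up to and
including the endpoint `s`. -/
lemma eqOn_of_eqOn (hV : IsDerivSeq V) (hU : IsDerivSeq U) {s : ℝ} (hs : 0 < s) (hs1 : s < 1)
    (h : EqOn (V 0) (U 0) (Icc 0 s)) (k : ℕ) : EqOn (V k) (U k) (Icc 0 s) := by
  have hsub : Icc 0 s ⊆ Ico 0 1 := Icc_subset_Ico_right hs1
  induction k with
  | zero => exact h
  | succ k ih =>
    intro t ht
    exact (uniqueDiffOn_Icc hs t ht).eq_deriv _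
      (((hV k t (hsub ht)).mono hsub).congr (fun x hx => (ih hx).symm) (ih ht).symm)
      ((hU k t (hsub ht)).mono hsub)

/-! ### Asymptotics at the initial point -/

/-- If `U 0` vanishes to order exactly `m` at `0`, then so does each derivative `U k` with
`k ≤ m`, to order `m - k` and with the leading coefficient of the Taylor polynomial. -/
lemma eventually_abs_sub_le (hU : IsDerivSeq U) {m : ℕ} {a η : ℝ} (ha : 0 < a) (hη : 0 < η)
    (h0 : ∀ k < m, U k 0 = 0) (hm : U m 0 = a) {k : ℕ} (hk : k ≤ m) :
    ∀ᶠ t in 𝓝[>] (0 : ℝ), |U k t - a * (t ^ (m - k) / (m - k).factorial)| ≤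
      η * a * (t ^ (m - k) / (m - k).factorial) := by
  -- the derivatives of `a * t ^ m / m!`; `Nat.descFactorial` vanishes beyond order `m`
  let P : ℕ → ℝ → ℝ := fun j t => a * (m.descFactorial j / m.factorial * t ^ (m - j))
  have hP : IsDerivSeq P := by
    intro j t _
    have h := (((hasDerivAt_pow (m - j) t).const_mul
      ((m.descFactorial j : ℝ) / m.factorial)).const_mul a).hasDerivWithinAt (s := Ico 0 1)
    refine h.congr_deriv ?_
    simp only [P, Nat.descFactorial_succ, Nat.sub_sub]
    push_cast
    ring
  have hP' : ∀ j ≤ m, ∀ t, P j t = a * (t ^ (m - j) / (m - j).factorial) := by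
    intro j hj t
    have h1 : ((m - j).factorial : ℝ) * m.descFactorial j = m.factorial := by
      exact_mod_cast Nat.factorial_mul_descFactorial hj
    have h2 : ((m - j).factorial : ℝ) ≠ 0 := by positivity
    have h3 : (m.factorial : ℝ) ≠ 0 := by positivity
    simp only [P]
    field_simp
    rw [← h1]
    ring
  have hW := (hU.sub hP).shift k
  have hlim := hU.tendsto_zero m
  rw [hm] at hlim
  have hev : ∀ᶠ t in 𝓝[>] (0 : ℝ), |U m t - a| ≤ η * a := by
    filter_upwards [Metric.tendsto_nhds.1 hlim (η * a) (by positivity)] with t ht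
    exact ht.le
  obtain ⟨δ, hδ, hδ'⟩ := (mem_nhdsGT_iff_exists_Ioo_subset).1 hev
  have hδ0 : (0 : ℝ) < δ := hδ
  filter_upwards [Ioo_mem_nhdsGT (show (0 : ℝ) < min δ 1 by positivity)] with t ht
  have htδ : t < δ := ht.2.trans_le (min_le_left _ _)
  have := hW.abs_le_of_abs_le le_rfl (ht.2.trans_le (min_le_right _ _)) (C := η * a) (r := 0)
    (n := m - k) ?_ ?_ t ⟨ht.1.le, le_rfl⟩
  · simpa [hP' k hk] using this
  · intro j hj
    have hj' : k + j < m := by omega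
    simp only [h0 _ hj', hP' _ hj'.le, zero_pow (show m - (k + j) ≠ 0 by omega)]
    simp
  · intro x hx
    simp only [Nat.add_sub_cancel' hk, hP' m le_rfl]
    rcases hx.1.eq_or_lt with rfl | hx0
    · simp [hm]; positivity
    · simpa using hδ' ⟨hx0, hx.2.trans_lt htδ⟩

/-- Near `0`, `t ^ n * U (n + 1) t / U 1 t` is asymptotically at most
`(m - n) / m * (m! / (m - n)!)`, and `(m - n) / m ≤ (m - 1) / m < 1 - 1 / (2 * m)`. -/
lemma eventually_ratio_le (hU : IsDerivSeq U) {n m : ℕ} (hn : 1 ≤ n) (hmn : n ≤ m) {a : ℝ}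
    (ha : 0 < a) (h0 : ∀ k < m, U k 0 = 0) (hm : U m 0 = a) :
    ∀ᶠ t in 𝓝[>] (0 : ℝ), 0 < U 1 t ∧ t ^ n * (m - n).factorial * |U (n + 1) t| ≤
      (1 - 1 / (2 * m)) * m.factorial * U 1 t := by
  have hm0 : (1 : ℝ) ≤ m := by exact_mod_cast hn.trans hmn
  have hmn' : ((m - n : ℕ) : ℝ) ≤ m - 1 := by
    rw [Nat.cast_sub hmn]
    have : (1 : ℝ) ≤ n := by exact_mod_cast hn
    linarith
  set d : ℝ := ((m - n : ℕ) : ℝ) with hd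
  have hd0 : 0 ≤ d := by positivity
  obtain ⟨η, hη, hη1, hηm⟩ : ∃ η : ℝ, 0 < η ∧ η < 1 ∧
      (1 + η) * d + η ≤ (1 - 1 / (2 * m)) * ((1 - η) * m) := by
    refine ⟨1 / (4 * m), by positivity, ?_, ?_⟩
    · rw [div_lt_one (by positivity)]; linarith
    · have h1 : (1 + 1 / (4 * m)) * d + 1 / (4 * m) ≤
          (1 + 1 / (4 * m)) * ((m : ℝ) - 1) + 1 / (4 * m) := by gcongr
      refine h1.trans ?_
      have : (0 : ℝ) < m := by linarith
      field_simp
      nlinarith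
  -- the leading term of `U (n + 1)` disappears if `n = m`
  have hA : ∀ᶠ t in 𝓝[>] (0 : ℝ),
      |U (n + 1) t| * t * (m - n).factorial ≤ ((1 + η) * d + η) * a * t ^ (m - n) := by
    rcases hmn.eq_or_lt with rfl | hlt
    · have hid : Tendsto (fun t : ℝ => t) (𝓝[>] 0) (𝓝 0) := tendsto_id.mono_left nhdsWithin_le_nhds
      have hlim : Tendsto (fun t => |U (n + 1) t| * t) (𝓝[>] 0) (𝓝 0) := by
        simpa using (hU.tendsto_zero (n + 1)).abs.mul hid
      filter_upwards [hlim.eventually_le_const (show 0 < η * a by positivity)] with t ht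
      simpa [hd] using ht
    · filter_upwards [hU.eventually_abs_sub_le ha hη h0 hm (k := n + 1) hlt, self_mem_nhdsWithin]
        with t ht ht0
      have ht0 : 0 < t := ht0
      obtain ⟨k, hk⟩ : ∃ k, m - n = k + 1 := ⟨m - n - 1, by omega⟩
      rw [show m - (n + 1) = k by omega] at ht
      have hdk : d = k + 1 := by rw [hd, hk]; push_cast; ring
      rw [hk, hdk]
      have hpos : 0 ≤ a * (t ^ k / k.factorial) := by positivity
      have h1 : |U (n + 1) t| ≤ (1 + η) * a * (t ^ k / k.factorial) := by
        rw [abs_le] at ht ⊢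
        constructor <;> nlinarith [ht.1, ht.2]
      calc |U (n + 1) t| * t * (k + 1).factorial
          ≤ (1 + η) * a * (t ^ k / k.factorial) * t * (k + 1).factorial := by gcongr
        _ = (1 + η) * (k + 1) * a * t ^ (k + 1) := by
            have : (k.factorial : ℝ) ≠ 0 := by positivity
            rw [Nat.factorial_succ]
            push_cast
            field_simp
            ring
        _ ≤ ((1 + η) * (k + 1) + η) * a * t ^ (k + 1) := by gcongr; linarith
  filter_upwards [hA, hU.eventually_abs_sub_le ha hη h0 hm (k := 1) (hn.trans hmn),
    self_mem_nhdsWithin] with t h1 h2 ht0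
  have ht0 : 0 < t := ht0
  have h3 : (1 - η) * a * (t ^ (m - 1) / (m - 1).factorial) ≤ U 1 t := by
    rw [abs_le] at h2; linarith [h2.1]
  have hη' : 0 < 1 - η := by linarith
  refine ⟨lt_of_lt_of_le (by positivity) h3, ?_⟩
  obtain ⟨j, rfl⟩ : ∃ j, n = j + 1 := ⟨n - 1, by omega⟩
  obtain ⟨i, rfl⟩ : ∃ i, m = i + 1 := ⟨m - 1, by omega⟩
  have hq : 0 ≤ 1 - 1 / (2 * ((i + 1 : ℕ) : ℝ)) := by
    rw [sub_nonneg, div_le_one (by positivity)]; linarith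
  calc t ^ (j + 1) * (i + 1 - (j + 1)).factorial * |U (j + 1 + 1) t|
      = t ^ j * (|U (j + 1 + 1) t| * t * (i + 1 - (j + 1)).factorial) := by ring
    _ ≤ t ^ j * (((1 + η) * d + η) * a * t ^ (i + 1 - (j + 1))) := by gcongr
    _ = ((1 + η) * d + η) * (a * t ^ i) := by
        rw [show i = j + (i + 1 - (j + 1)) by omega, pow_add,
          show j + (i + 1 - (j + 1)) + 1 - (j + 1) = i + 1 - (j + 1) by omega]
        ring
    _ ≤ (1 - 1 / (2 * (i + 1 : ℕ))) * ((1 - η) * (i + 1 : ℕ)) * (a * t ^ i) := by gcongr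
    _ = (1 - 1 / (2 * (i + 1 : ℕ))) * (i + 1).factorial *
          ((1 - η) * a * (t ^ (i + 1 - 1) / (i + 1 - 1).factorial)) := by
        have : (i.factorial : ℝ) ≠ 0 := by positivity
        rw [Nat.factorial_succ, Nat.add_sub_cancel]
        push_cast
        field_simp
    _ ≤ _ := by gcongr

/-! ### Uniqueness at the initial point -/

/-- Uniqueness on some interval `[0,δ]`. There `f` need not be Lipschitz, and the comparison works
because `V` has the same leading term as `U`, so that `V x = U y` for some `y` close to `x`
relative to `x`. -/
lemma exists_eqOn_of_vanish (hU : IsDerivSeq U) (hV : IsDerivSeq V) {n m : ℕ} (hn : 1 ≤ n)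
    (hmn : n ≤ m) {f : ℝ → ℝ} {a : ℝ} (ha : 0 < a)
    (hfU : ∀ t ∈ Ico (0 : ℝ) 1, U n t = f (U 0 t)) (hfV : ∀ t ∈ Ico (0 : ℝ) 1, V n t = f (V 0 t))
    (hU0 : ∀ k < m, U k 0 = 0) (hUm : U m 0 = a) (hV0 : ∀ k < m, V k 0 = 0) (hVm : V m 0 = a) :
    ∃ δ > 0, EqOn (V 0) (U 0) (Icc 0 δ) := by
  have hm1 : 1 ≤ m := hn.trans hmn
  have hm0 : (1 : ℝ) ≤ m := by exact_mod_cast hm1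
  set p : ℝ := 1 - 1 / (2 * m) with hp
  have hp1 : p < 1 := by rw [hp]; simp; linarith
  have hp0 : 0 ≤ p := by rw [hp, sub_nonneg, div_le_one (by positivity)]; linarith
  obtain ⟨q, hpq, hq1⟩ := exists_between hp1
  have hq0 : 0 ≤ q := hp0.trans hpq.le
  -- the factor `(1 - η) ^ n` pays for evaluating the bound of `U (n + 1) / U 1` away from `t`
  obtain ⟨η, ⟨hη, hη1⟩, hηq⟩ : ∃ η : ℝ, η ∈ Ioo (0 : ℝ) 1 ∧ p < q * (1 - η) ^ n := by
    have hc : Tendsto (fun η : ℝ => q * (1 - η) ^ n) (𝓝[>] 0) (𝓝 (q * (1 - 0) ^ n)) :=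
      (Continuous.tendsto (by fun_prop) 0).mono_left nhdsWithin_le_nhds
    have h1 := hc.eventually_const_lt (show p < q * (1 - 0) ^ n by simpa using hpq)
    have h2 : ∀ᶠ η : ℝ in 𝓝[>] 0, η ∈ Ioo (0 : ℝ) 1 := Ioo_mem_nhdsGT one_pos
    exact (h2.and h1).exists
  have hη' : 0 < 1 - η := by linarith
  have hθ : 0 < η / 3 := by positivity
  have hUas := hU.eventually_abs_sub_le ha hθ hU0 hUm (Nat.zero_le m)
  have hVas := hV.eventually_abs_sub_le ha hθ hV0 hVm (Nat.zero_le m)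
  have hev := (hU.eventually_ratio_le hn hmn ha hU0 hUm).and (hUas.and hVas)
  obtain ⟨δ₁, hδ₁, hsub⟩ := mem_nhdsGT_iff_exists_Ioo_subset.1 hev
  have hδ₁ : (0 : ℝ) < δ₁ := hδ₁
  -- points of `[0, δ]` times `1 + η < 2` stay below both `δ₁` and `1`
  have hδ0 : 0 < min δ₁ 1 / 3 := by positivity
  refine ⟨min δ₁ 1 / 3, hδ0, fun t ht => sub_eq_zero.1 ?_⟩
  have hmin1 := min_le_left δ₁ 1
  have hmin2 := min_le_right δ₁ 1
  refine (hV.sub hU).eq_zero_of_abs_le (n := n) (r := m - n) le_rfl (by linarith) hq0 hq1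
    (fun k hk => ?_) (fun x hx => ?_) t ht
  · rw [Nat.sub_add_cancel hmn] at hk
    rcases hk.eq_or_lt with rfl | hk
    · simp [hUm, hVm]
    · simp [hU0 k hk, hV0 k hk]
  rw [Nat.sub_add_cancel hmn, sub_zero]
  have hx0 : 0 < x := hx.1
  have hmem : ∀ z ∈ Icc ((1 - η) * x) ((1 + η) * x), 0 < z ∧ z < δ₁ ∧ z < 1 := by
    intro z hz
    have h1 : 0 < (1 - η) * x := by positivity
    have h2 : (1 + η) * x ≤ 2 * x := by gcongr; linarith
    have := hx.2
    exact ⟨h1.trans_le hz.1, by linarith [hz.2], by linarith [hz.2]⟩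
  have hxI : x ∈ Icc ((1 - η) * x) ((1 + η) * x) := by constructor <;> nlinarith
  have hle : (1 - η) * x ≤ (1 + η) * x := hxI.1.trans hxI.2
  set c : ℝ := a * (x ^ m / m.factorial) with hc
  have hc0 : 0 < c := by positivity
  have hUb : ∀ z ∈ Icc ((1 - η) * x) ((1 + η) * x),
      |U 0 z - a * (z ^ m / m.factorial)| ≤ η / 3 * a * (z ^ m / m.factorial) := fun z hz => by
    simpa using (hsub ⟨(hmem z hz).1, (hmem z hz).2.1⟩).2.1
  have hVb : |V 0 x - c| ≤ η / 3 * c := by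
    have := (hsub ⟨(hmem x hxI).1, (hmem x hxI).2.1⟩).2.2
    simpa [hc, mul_assoc] using this
  have hlow : U 0 ((1 - η) * x) ≤ V 0 x := by
    have h1 := hUb _ (left_mem_Icc.2 hle)
    have h2 : a * (((1 - η) * x) ^ m / m.factorial) = (1 - η) ^ m * c := by
      rw [hc, mul_pow]; ring
    rw [mul_assoc, h2, abs_le] at h1
    rw [abs_le] at hVb
    have h3 : (1 - η) ^ m ≤ 1 - η := pow_le_of_le_one hη'.le (by linarith) (by omega)
    have h4 : (1 + η / 3) * ((1 - η) ^ m * c) ≤ (1 + η / 3) * ((1 - η) * c) := by gcongr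
    have h5 : (1 + η / 3) * ((1 - η) * c) ≤ (1 - η / 3) * c := by
      rw [← mul_assoc]
      exact mul_le_mul_of_nonneg_right (by nlinarith) hc0.le
    linarith [h1.2, hVb.1]
  have hhigh : V 0 x ≤ U 0 ((1 + η) * x) := by
    have h1 := hUb _ (right_mem_Icc.2 hle)
    have h2 : a * (((1 + η) * x) ^ m / m.factorial) = (1 + η) ^ m * c := by
      rw [hc, mul_pow]; ring
    rw [mul_assoc, h2, abs_le] at h1
    rw [abs_le] at hVb
    have h3 : 1 + η ≤ (1 + η) ^ m := le_self_pow₀ (by linarith) (by omega)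
    have h4 : (1 - η / 3) * ((1 + η) * c) ≤ (1 - η / 3) * ((1 + η) ^ m * c) := by
      have : 0 ≤ 1 - η / 3 := by linarith
      gcongr
    have h5 : (1 + η / 3) * c ≤ (1 - η / 3) * ((1 + η) * c) := by
      rw [← mul_assoc (1 - η / 3)]
      exact mul_le_mul_of_nonneg_right (by nlinarith) hc0.le
    linarith [h1.1, hVb.2]
  have hsubI : Icc ((1 - η) * x) ((1 + η) * x) ⊆ Ioo 0 1 := fun z hz =>
    ⟨(hmem z hz).1, (hmem z hz).2.2⟩
  obtain ⟨y, hy, hyx⟩ := intermediate_value_Icc hle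
    ((hU.continuousOn 0).mono (hsubI.trans Ioo_subset_Ico_self)) ⟨hlow, hhigh⟩
  have hVn : V n x = U n y := by
    rw [hfV x (Ioo_subset_Ico_self (hsubI hxI)), hfU y (Ioo_subset_Ico_self (hsubI hy)), hyx]
  have hB : (0 : ℝ) ≤ q * m.factorial / (x ^ n * (m - n).factorial) := by positivity
  have key := hU.abs_sub_le (n := n) hB (hsubI hxI) (hsubI hy) (fun z hz => by
    have hzI := ordConnected_Icc.uIcc_subset hxI hy hz
    have hz0 := (hmem z hzI).1
    obtain ⟨hU1, hr⟩ := (hsub ⟨hz0, (hmem z hzI).2.1⟩).1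
    have hxz : ((1 - η) * x) ^ n ≤ z ^ n := by gcongr; exact hzI.1
    rw [mul_pow] at hxz
    have hη'' : 0 < (1 - η) ^ n := by positivity
    rw [div_mul_eq_mul_div, le_div_iff₀ (by positivity), ← mul_le_mul_iff_right₀ hη'']
    calc (1 - η) ^ n * (|U (n + 1) z| * (x ^ n * (m - n).factorial))
        = (1 - η) ^ n * x ^ n * (m - n).factorial * |U (n + 1) z| := by ring
      _ ≤ z ^ n * (m - n).factorial * |U (n + 1) z| := by gcongr
      _ ≤ p * m.factorial * U 1 z := hr
      _ ≤ q * (1 - η) ^ n * m.factorial * U 1 z := by gcongr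
      _ = _ := by ring)
  rw [hVn, ← hyx]
  rw [div_mul_eq_mul_div, le_div_iff₀ (by positivity)] at key
  linarith

/-! ### Uniqueness beyond the initial point -/

/-- Uniqueness continues to the right past a point `s > 0` where the solution has positive
derivative. -/
lemma exists_eqOn_of_deriv_pos (hU : IsDerivSeq U) (hV : IsDerivSeq V) {n : ℕ} (hn : 1 ≤ n)
    {f : ℝ → ℝ}
    (hfU : ∀ t ∈ Ico (0 : ℝ) 1, U n t = f (U 0 t)) (hfV : ∀ t ∈ Ico (0 : ℝ) 1, V n t = f (V 0 t))
    {s : ℝ} (hs : s ∈ Ioo (0 : ℝ) 1) (hUs : 0 < U 1 s) (h : EqOn (V 0) (U 0) (Icc 0 s)) :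
    ∃ δ > 0, EqOn (V 0) (U 0) (Icc s (s + δ)) := by
  have hcont : ∀ k, ContinuousAt (U k) s := fun k => (hU.hasDerivAt k hs).continuousAt
  have hB0 : 0 ≤ |U (n + 1) s| / U 1 s + 1 := by positivity
  set B : ℝ := |U (n + 1) s| / U 1 s + 1 with hB
  have hev : ∀ᶠ t in 𝓝 s, t ∈ Ioo (0 : ℝ) 1 ∧ 0 < U 1 t ∧ |U (n + 1) t| < B * U 1 t := by
    have h1 : ∀ᶠ t in 𝓝 s, t ∈ Ioo (0 : ℝ) 1 := isOpen_Ioo.mem_nhds hs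
    refine h1.and (((hcont 1).eventually_const_lt hUs).and
      ((hcont (n + 1)).abs.eventually_lt ((hcont 1).const_mul B) ?_))
    rw [hB, add_mul, div_mul_cancel₀ _ hUs.ne']
    linarith
  obtain ⟨ρ, hρ, hsub⟩ := Metric.nhds_basis_closedBall.mem_iff.1 hev
  rw [Real.closedBall_eq_Icc] at hsub
  have hmono : StrictMonoOn (U 0) (Icc (s - ρ) (s + ρ)) := by
    refine strictMonoOn_of_deriv_pos (convex_Icc _ _)
      (fun z hz => (hU.hasDerivAt 0 (hsub hz).1).continuousAt.continuousWithinAt) (fun z hz => ?_)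
    rw [(hU.hasDerivAt 0 (hsub (interior_subset hz)).1).deriv]
    exact (hsub (interior_subset hz)).2.1
  have hsI : s ∈ Icc (s - ρ) (s + ρ) := ⟨by linarith, by linarith⟩
  have hle : s - ρ ≤ s + ρ := by linarith
  have hVs : V 0 s = U 0 s := h ⟨hs.1.le, le_rfl⟩
  have hVc : ContinuousAt (V 0) s := (hV.hasDerivAt 0 hs).continuousAt
  have hpow : ContinuousAt (fun t => (t - s) ^ n * B) s := by fun_prop
  have hev2 : ∀ᶠ t in 𝓝 s, (t ∈ Icc (s - ρ) (s + ρ) ∧ V 0 t ∈ Icc (U 0 (s - ρ)) (U 0 (s + ρ))) ∧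
      (t - s) ^ n * B < 1 / 2 * n.factorial := by
    have h1 : ∀ᶠ t in 𝓝 s, t ∈ Icc (s - ρ) (s + ρ) := Icc_mem_nhds (by linarith) (by linarith)
    have h2 : ∀ᶠ t in 𝓝 s, V 0 t ∈ Icc (U 0 (s - ρ)) (U 0 (s + ρ)) :=
      hVc (Icc_mem_nhds ?_ ?_)
    · refine (h1.and h2).and (hpow.eventually_lt_const ?_)
      simp only [sub_self, zero_pow (show n ≠ 0 by omega), zero_mul]
      positivity
    · rw [hVs]; exact hmono (left_mem_Icc.2 hle) hsI (by linarith)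
    · rw [hVs]; exact hmono hsI (right_mem_Icc.2 hle) (by linarith)
  obtain ⟨δ, hδ, hsub2⟩ := Metric.nhds_basis_closedBall.mem_iff.1 hev2
  rw [Real.closedBall_eq_Icc] at hsub2
  refine ⟨δ, hδ, fun t ht => sub_eq_zero.1 ?_⟩
  have hb : s + δ < 1 := (hsub (hsub2 ⟨by linarith, le_rfl⟩).1.1).1.2
  refine (hV.sub hU).eq_zero_of_abs_le (n := n) (r := 0) (q := 1 / 2) hs.1.le hb (by norm_num)
    (by norm_num) (fun k _ => sub_eq_zero.2 (hV.eqOn_of_eqOn hU hs.1 hs.2 h k ⟨hs.1.le, le_rfl⟩))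
    (fun x hx => ?_) t ht
  obtain ⟨⟨hxI, hVx⟩, hxB⟩ := hsub2 ⟨by linarith [hx.1], hx.2⟩
  obtain ⟨y, hy, hyx⟩ := intermediate_value_Icc hle
    (fun z hz => (hU.hasDerivAt 0 (hsub hz).1).continuousAt.continuousWithinAt) hVx
  have hVn : V n x = U n y := by
    rw [hfV x (Ioo_subset_Ico_self (hsub hxI).1), hfU y (Ioo_subset_Ico_self (hsub hy).1), hyx]
  have key := hU.abs_sub_le (n := n) hB0 (hsub hxI).1 (hsub hy).1
    (fun z hz => (hsub (ordConnected_Icc.uIcc_subset hxI hy hz)).2.2.le)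
  rw [hVn, ← hyx, zero_add, Nat.factorial_zero, Nat.cast_one, mul_one]
  have hx0 : 0 ≤ (x - s) ^ n := pow_nonneg (sub_nonneg.2 hx.1.le) n
  calc (x - s) ^ n * |U n y - U n x| ≤ (x - s) ^ n * (B * |U 0 y - U 0 x|) := by gcongr
    _ = (x - s) ^ n * B * |U 0 y - U 0 x| := by ring
    _ ≤ _ := by gcongr

end IsDerivSeq

/-! ### Solutions of the autonomous equation -/

namespace IsVanishingSolution

variable {n m : ℕ} {f : ℝ → ℝ} {a : ℝ} {u : ℝ → ℝ}

lemma isDerivSeq (hu : IsVanishingSolution n m f a u) :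
    IsDerivSeq fun k => iteratedDerivWithin k u (Ico 0 1) := by
  intro k t ht
  have hd : DifferentiableWithinAt ℝ (iteratedDerivWithin k u (Ico 0 1)) (Ico 0 1) t :=
    (hu.smooth.differentiableOn_iteratedDerivWithin (m := k)
      (by exact_mod_cast ENat.natCast_lt_top k) (uniqueDiffOn_Ico 0 1)) t ht
  simpa only [iteratedDerivWithin_succ] using hd.hasDerivWithinAt

lemma neg (hu : IsVanishingSolution n m f a u) :
    IsVanishingSolution n m (fun y => -f (-y)) (-a) (-u) where
  smooth := hu.smooth.neg
  equation t ht := by simp [iteratedDerivWithin_neg, hu.equation t ht]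
  vanish k hk := by simp [iteratedDerivWithin_neg, hu.vanish k hk]
  leading := by simp [iteratedDerivWithin_neg, hu.leading]

end IsVanishingSolution

theorem theorem2 (n m : ℕ) (hn : 1 ≤ n) (hmn : n ≤ m) (f : ℝ → ℝ) (a : ℝ) (ha : a ≠ 0)
    (u : ℝ → ℝ) (hu : IsVanishingSolution n m f a u) :
    ∃ ε ∈ Ioc (0 : ℝ) 1, ∀ v : ℝ → ℝ, IsVanishingSolution n m f a v →
      ∀ t ∈ Ico (0 : ℝ) ε, v t = u t := by
  -- `-u` solves the equation with right-hand side `y ↦ -f (-y)` and leading derivative `-a`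
  wlog hpos : 0 < a generalizing f a u
  · have hneg : 0 < -a := neg_pos.2 (lt_of_le_of_ne (not_lt.1 hpos) ha)
    obtain ⟨ε, hε, h⟩ := this _ (-a) (neg_ne_zero.2 ha) (-u) hu.neg hneg
    exact ⟨ε, hε, fun v hv t ht => neg_injective (h (-v) hv.neg t ht)⟩
  have hU := hu.isDerivSeq
  obtain ⟨ε₀, hε₀, hsub⟩ := mem_nhdsGT_iff_exists_Ioo_subset.1
    (hU.eventually_ratio_le hn hmn hpos hu.vanish hu.leading)
  have hε₀ : (0 : ℝ) < ε₀ := hε₀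
  -- `ε` depends on `u` only: `u' > 0` on `(0, ε)`
  refine ⟨min ε₀ 1, ⟨by positivity, min_le_right _ _⟩, fun v hv t ht => ?_⟩
  have hV := hv.isDerivSeq
  have ht1 : t < 1 := ht.2.trans_le (min_le_right _ _)
  have hIcc : Icc 0 t ⊆ Ico (0 : ℝ) 1 := Icc_subset_Ico_right ht1
  have h00 : v 0 = u 0 := by
    have h1 := hu.vanish 0 (by omega)
    have h2 := hv.vanish 0 (by omega)
    simp only [iteratedDerivWithin_zero] at h1 h2
    rw [h1, h2]
  -- the set of `s` such that `u` and `v` agree on `[0, s]`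
  let S : Set ℝ := {s | EqOn v u (Icc 0 s)}
  suffices t ∈ S from this ⟨ht.1, le_rfl⟩
  have hclosed : IsClosed (S ∩ Icc 0 t) := by
    have hT : IsClosed (Icc 0 t ∩ (fun s => v s - u s) ⁻¹' {0}) :=
      ((hv.smooth.continuousOn.sub hu.smooth.continuousOn).mono hIcc).preimage_isClosed_of_isClosed
        isClosed_Icc isClosed_singleton
    have hST : S ∩ Icc 0 t ⊆ Icc 0 t ∩ (fun s => v s - u s) ⁻¹' {0} := fun s hs =>
      ⟨hs.2, sub_eq_zero.2 (hs.1 ⟨hs.2.1, le_rfl⟩)⟩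
    refine isClosed_of_closure_subset fun x hx => ?_
    obtain ⟨hxI, hxT⟩ := closure_minimal hST hT hx
    refine ⟨fun y hy => ?_, hxI⟩
    rcases hy.2.eq_or_lt with rfl | hyx
    · exact sub_eq_zero.1 hxT
    · obtain ⟨s, hys, hs⟩ := mem_closure_iff.1 hx (Ioi y) isOpen_Ioi hyx
      exact hs.1 ⟨hy.1, le_of_lt hys⟩
  refine hclosed.Icc_subset_of_forall_exists_gt ?_ ?_ ⟨ht.1, le_rfl⟩
  · intro x hx
    rw [Icc_self, mem_singleton_iff] at hx
    rw [hx, h00]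
  · rintro s ⟨hs, hst⟩ y hy
    have hs : EqOn v u (Icc 0 s) := hs
    obtain ⟨δ, hδ, h⟩ : ∃ δ > 0, EqOn v u (Icc s (s + δ)) := by
      rcases hst.1.eq_or_lt with rfl | hs0
      · simpa using hU.exists_eqOn_of_vanish hV hn hmn hpos hu.equation hv.equation hu.vanish
          hu.leading hv.vanish hv.leading
      · simpa using hU.exists_eqOn_of_deriv_pos hV hn hu.equation hv.equation
          ⟨hs0, hst.2.trans ht1⟩
          (hsub ⟨hs0, hst.2.trans (ht.2.trans_le (min_le_left _ _))⟩).1 (by simpa using hs)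
    have hlt : s < min y (s + δ) := lt_min hy (by linarith)
    refine ⟨min y (s + δ), fun x hx => ?_, hlt, min_le_left _ _⟩
    rcases le_total x s with hxs | hxs
    · exact hs ⟨hx.1, hxs⟩
    · exact h ⟨hxs, hx.2.trans (min_le_right _ _)⟩
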